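/- For an integer $k\ge 0$ let $d_k(n)$, $n\ge 0$, denote the $k$-elongated plane partition function, defined by the generating function $$\sum_{n=0}^{\infty}d_k(n)q^n=\prod_{m=1}^{\infty}\frac{(1-q^{2m})^k}{(1-q^m)^{3k+1}}$$ in $\mathbb{Z}[[q]]$. Then for all integers $k\ge 0$ and $n\ge 0$, $$d_{7k}(7n+5)\equiv 0\pmod 7\qquad\text{and}\qquad d_{7k+5}(7n+2)\equiv 0\pmod 7.$$ -/

import Mathlib

open PowerSeries
open scoped PowerSeries.WithPiTopology

/-- The factor `(1 - q ^ (2 * m)) ^ k / (1 - q ^ m) ^ (3 * k + 1)` in `ℤ⟦q⟧`. For `m ≥ 1` the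
denominator has constant coefficient `1`, so it is invertible in `ℤ⟦q⟧`; see `diamondFactor_mul`. -/
noncomputable def diamondFactor (k m : ℕ) : PowerSeries ℤ :=
  (1 - X ^ (2 * m)) ^ k * invOfUnit ((1 - X ^ m) ^ (3 * k + 1)) 1

/-- The generating function
`D_k(q) = ∏_{m ≥ 1} (1 - q ^ (2 * m)) ^ k / (1 - q ^ m) ^ (3 * k + 1)` in `ℤ⟦q⟧`, an infinite
product in the topology of coefficientwise convergence (with `ℤ` discrete). It converges
unconditionally; see `multipliable_diamondFactor`. -/
noncomputable def diamondSeries (k : ℕ) : PowerSeries ℤ :=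
  ∏' m : ℕ, diamondFactor k (m + 1)

/-- `d_k(n)`, the `k`-elongated plane partition function, defined by its generating function: the
coefficient of `q ^ n` in `D_k(q)`. -/
noncomputable def diamondCount (k n : ℕ) : ℤ :=
  coeff n (diamondSeries k)

/-- The inverse in `diamondFactor` is a true inverse. -/
theorem diamondFactor_mul (k m : ℕ) (hm : 1 ≤ m) :
    diamondFactor k m * (1 - X ^ m) ^ (3 * k + 1) = (1 - X ^ (2 * m)) ^ k := by
  have h : constantCoeff ((1 - X ^ m : PowerSeries ℤ) ^ (3 * k + 1)) = ((1 : ℤˣ) : ℤ) := by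
    simp [show m ≠ 0 by omega]
  rw [diamondFactor, mul_assoc, invOfUnit_mul _ _ h, mul_one]

/-- The infinite product defining `diamondSeries` converges. -/
theorem multipliable_diamondFactor (k : ℕ) :
    Multipliable (fun m : ℕ => diamondFactor k (m + 1)) := by
  have hdvd : ∀ m : ℕ, (X : PowerSeries ℤ) ^ (m + 1) ∣ diamondFactor k (m + 1) - 1 := by
    intro m
    have h : constantCoeff ((1 - X ^ (m + 1) : PowerSeries ℤ) ^ (3 * k + 1)) = ((1 : ℤˣ) : ℤ) := by
      simp
    have hA : (X : PowerSeries ℤ) ^ (m + 1) ∣ (1 - X ^ (2 * (m + 1))) ^ k - 1 := by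
      have h1 := sub_dvd_pow_sub_pow (1 - X ^ (2 * (m + 1)) : PowerSeries ℤ) 1 k
      rw [one_pow] at h1
      refine dvd_trans ⟨-X ^ (m + 1), ?_⟩ h1
      ring
    have hB : (X : PowerSeries ℤ) ^ (m + 1) ∣ (1 - X ^ (m + 1)) ^ (3 * k + 1) - 1 := by
      have h1 := sub_dvd_pow_sub_pow (1 - X ^ (m + 1) : PowerSeries ℤ) 1 (3 * k + 1)
      rw [one_pow] at h1
      refine dvd_trans ⟨-1, ?_⟩ h1
      ring
    have e : diamondFactor k (m + 1) - 1 =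
        (((1 - X ^ (2 * (m + 1))) ^ k - 1) - ((1 - X ^ (m + 1)) ^ (3 * k + 1) - 1)) *
          invOfUnit ((1 - X ^ (m + 1)) ^ (3 * k + 1)) 1 := by
      rw [sub_sub_sub_cancel_right, sub_mul, mul_invOfUnit _ _ h, diamondFactor]
    rw [e]
    exact (dvd_sub hA hB).mul_right _
  have key := PowerSeries.WithPiTopology.multipliable_one_add_of_tendsto_order_atTop_nhds_top
    (R := ℤ) (f := fun m : ℕ => diamondFactor k (m + 1) - 1) (by
      refine ENat.tendsto_nhds_top_iff_natCast_lt.mpr fun n => ?_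
      filter_upwards [Filter.eventually_ge_atTop n] with m hm
      refine lt_of_lt_of_le ?_ (nat_le_order _ (m + 1) (X_pow_dvd_iff.mp (hdvd m)))
      exact_mod_cast Nat.lt_succ_of_le hm)
  simpa using key

/-!
Write `f₁ = (q; q)_∞` and `f₂ = (q ^ 2; q ^ 2)_∞`, so that `D_k f₁ ^ (3 k + 1) = f₂ ^ k`
(`diamondSeries_mul_eulerProd_pow`). Modulo `7` the seventh power of a series is a series in
`q ^ 7`, and multiplying by a unit series in `q ^ 7` does not affect whether all coefficients in a given
residue class vanish (`coeff_eq_zero_of_mul_expand`). Hence, up to such factors, `D_{7 k}` is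
`f₁ ^ 6` and `D_{7 k + 5}` is `f₁ ^ 5 f₂ ^ 5`, which is `f₁ ^ 5 / f₂ ^ 2`.

For `f₁ ^ 6`, this is Ramanujan's argument for `p(7 n + 5)`: by Jacobi's identity
`2 f₁ ^ 3 = ∑ (-1) ^ i (1 - 2 i) q ^ (i (i - 1) / 2)`, an exponent `7 n + 5` in the square of this
series forces `(1 - 2 a) ^ 2 + (1 - 2 b) ^ 2 ≡ 0` modulo `7`, and so `7 ∣ 1 - 2 a`, as `-1` is not a
square modulo `7`.

For `f₁ ^ 5 / f₂ ^ 2` the point is that it equals the theta series `∑ (1 - 6 r) q ^ (r (3 r - 1) / 2)`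
(`eulerProd_pow_five`): an exponent `7 n + 2` forces `7 ∣ (1 - 6 r) ^ 2`. This identity is the
derivative of the quintuple product identity. It is obtained here by multiplying Jacobi's series by
Gauss's series `f₁ ^ 2 / f₂ = ∑ (-1) ^ n q ^ (n ^ 2)` and sorting the index pairs `(m, n)` by
`m + 2 n` modulo `3`: two residue classes each give `f₂ ∑ (1 - 6 r) q ^ (r (3 r - 1) / 2)`, through
Euler's pentagonal number theorem for `f₂`, and the third class cancels.

The identities of Gauss and Jacobi are limits of finite identities, namely of the `q`-binomial
theorem and of its derivative at a zero of the product (`hasSum_of_sum_qBinom`).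
-/

open Finset.HasAntidiagonal (antidiagonal)

/-! ### The `q`-binomial theorem -/

section QBinomial

variable {A : Type*} [CommRing A]

/-- The finite `q`-Pochhammer symbol `(q; q)_n = ∏_{1 ≤ j ≤ n} (1 - q ^ j)`. -/
def qPoch (q : A) (n : ℕ) : A := ∏ j ∈ Finset.range n, (1 - q ^ (j + 1))

/-- The Gaussian binomial coefficient `[k + l choose k]_q`, indexed by the pair `(k, l)` and
defined by the `q`-Pascal rule, so that no division is needed. -/
def qBinom (q : A) : ℕ → ℕ → A
  | 0, _ => 1
  | _ + 1, 0 => 1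
  | k + 1, l + 1 => qBinom q k (l + 1) + q ^ (k + 1) * qBinom q (k + 1) l

theorem qPoch_succ (q : A) (n : ℕ) : qPoch q (n + 1) = qPoch q n * (1 - q ^ (n + 1)) :=
  Finset.prod_range_succ _ _

@[simp] theorem qBinom_zero_left (q : A) (l : ℕ) : qBinom q 0 l = 1 := by
  simp [qBinom]

@[simp] theorem qBinom_zero_right (q : A) (k : ℕ) : qBinom q k 0 = 1 := by
  cases k <;> simp [qBinom]

theorem qBinom_succ_succ (q : A) (k l : ℕ) :
    qBinom q (k + 1) (l + 1) = qBinom q k (l + 1) + q ^ (k + 1) * qBinom q (k + 1) l := by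
  rw [qBinom]

theorem qBinom_mul_qPoch (q : A) (k l : ℕ) :
    qBinom q k l * (qPoch q k * qPoch q l) = qPoch q (k + l) := by
  induction k generalizing l with
  | zero => simp [qPoch]
  | succ k ihk =>
    induction l with
    | zero => simp [qPoch]
    | succ l ihl =>
      have h1 := ihk (l + 1)
      rw [show k + (l + 1) = k + l + 1 by ring] at h1
      rw [show k + 1 + l = k + l + 1 by ring] at ihl
      rw [qBinom_succ_succ, show k + 1 + (l + 1) = k + l + 1 + 1 by ring, qPoch_succ q (k + l + 1),
        qPoch_succ q k, qPoch_succ q l]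
      rw [qPoch_succ q l] at h1
      rw [qPoch_succ q k] at ihl
      linear_combination (1 - q ^ (k + 1)) * h1 + q ^ (k + 1) * (1 - q ^ (l + 1)) * ihl

/-- The `q`-binomial theorem (Rothe's identity), in homogeneous form. -/
theorem prod_add_mul_pow_eq_sum_qBinom (q x y : A) (N : ℕ) :
    ∏ j ∈ Finset.range N, (y + x * q ^ j) =
      ∑ p ∈ antidiagonal N, q ^ (p.1.choose 2) * qBinom q p.1 p.2 * x ^ p.1 * y ^ p.2 := by
  induction N generalizing x with
  | zero => simp
  | succ N ih =>
    have h : ∏ j ∈ Finset.range N, (y + x * q ^ (j + 1)) =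
        ∏ j ∈ Finset.range N, (y + x * q * q ^ j) :=
      Finset.prod_congr rfl fun j _ => by ring
    rw [Finset.prod_range_succ', h, ih (x * q), pow_zero, mul_one, mul_add,
      Finset.sum_mul, Finset.sum_mul]
    -- The middle terms combine by the `q`-Pascal rule; the two extreme ones stand alone.
    cases N with
    | zero =>
      rw [Finset.Nat.sum_antidiagonal_succ]
      simp
    | succ N =>
      rw [Finset.Nat.sum_antidiagonal_succ, Finset.Nat.sum_antidiagonal_succ' (n := N),
        Finset.Nat.sum_antidiagonal_succ (n := N + 1),
        Finset.Nat.sum_antidiagonal_succ' (n := N)]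
      have hs : ∀ p : ℕ × ℕ, q ^ ((p.1 + 1).choose 2) * qBinom q (p.1 + 1) (p.2 + 1) *
            x ^ (p.1 + 1) * y ^ (p.2 + 1) =
          q ^ ((p.1 + 1).choose 2) * qBinom q (p.1 + 1) p.2 * (x * q) ^ (p.1 + 1) * y ^ p.2 * y +
          q ^ (p.1.choose 2) * qBinom q p.1 (p.2 + 1) * (x * q) ^ p.1 * y ^ (p.2 + 1) * x := by
        intro p
        rw [qBinom_succ_succ, show (p.1 + 1).choose 2 = p.1 + p.1.choose 2 by
          simp [Nat.choose_succ_succ']]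
        ring
      simp only [hs, Finset.sum_add_distrib]
      rw [show (N + 1 + 1).choose 2 = (N + 1) + (N + 1).choose 2 by
          simp [Nat.choose_succ_succ' (N + 1) 1]]
      simp
      ring

theorem map_qBinom {B : Type*} [CommRing B] (f : A →+* B) (q : A) (k l : ℕ) :
    f (qBinom q k l) = qBinom (f q) k l := by
  induction k generalizing l with
  | zero => simp
  | succ k ihk =>
    induction l with
    | zero => simp
    | succ l ihl => simp [qBinom_succ_succ, ihk, ihl]

/-- The derivative of the `q`-binomial theorem with respect to `y`, at the zero `y = q ^ n`. -/
theorem sum_qBinom_mul_natCast (q : A) {n N : ℕ} (hn : n < N) :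
    ∑ p ∈ antidiagonal N,
        q ^ (p.1.choose 2) * qBinom q p.1 p.2 * (-1) ^ p.1 * (p.2 : A) * (q ^ n) ^ p.2 =
      q ^ n * ∏ j ∈ (Finset.range N).erase n, (q ^ n - q ^ j) := by
  have h := prod_add_mul_pow_eq_sum_qBinom (Polynomial.C q) (-1) Polynomial.X N
  have hs : ∀ p : ℕ × ℕ, Polynomial.C q ^ (p.1.choose 2) * qBinom (Polynomial.C q) p.1 p.2 *
      (-1) ^ p.1 * Polynomial.X ^ p.2 =
      Polynomial.C (q ^ (p.1.choose 2) * qBinom q p.1 p.2 * (-1) ^ p.1) * Polynomial.X ^ p.2 := by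
    intro p
    simp [map_qBinom]
  have hp : ∀ j : ℕ, (Polynomial.X + -1 * Polynomial.C q ^ j : Polynomial A) =
      Polynomial.X - Polynomial.C (q ^ j) := by
    intro j
    simp [sub_eq_add_neg]
  simp only [hs, hp] at h
  rw [← Finset.mul_prod_erase _ _ (Finset.mem_range.2 hn)] at h
  have h2 := congrArg (fun f => q ^ n * Polynomial.eval (q ^ n) (Polynomial.derivative f)) h
  simp only [Polynomial.derivative_mul (f := Polynomial.X - _), Polynomial.derivative_sum,
    Polynomial.derivative_C_mul_X_pow, Polynomial.eval_finsetSum, Polynomial.eval_add,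
    Polynomial.eval_mul, Polynomial.derivative_sub, Polynomial.derivative_X,
    Polynomial.derivative_C, Polynomial.eval_sub, Polynomial.eval_X, Polynomial.eval_C,
    Polynomial.eval_prod, Polynomial.eval_pow, sub_self, zero_mul, add_zero, sub_zero,
    one_mul] at h2
  rw [h2, Finset.mul_sum]
  refine Finset.sum_congr rfl fun p _ => ?_
  rcases p with ⟨k, _ | l⟩
  · simp
  · simp only [Nat.add_sub_cancel]
    ring

end QBinomial

/-! ### Finite forms of the identities of Gauss and Jacobi -/

section FiniteIdentities

/-- The triangular numbers `i (i - 1) / 2`, for all integers `i`. -/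
def triangular (i : ℤ) : ℕ := (i * (i - 1) / 2).toNat

theorem two_mul_triangular (i : ℤ) : 2 * (triangular i : ℤ) = i * (i - 1) := by
  have h0 : 0 ≤ i * (i - 1) := by
    rcases le_or_gt i 0 with h | h <;> nlinarith
  have h2 : Even (i * (i - 1)) := by
    have := Int.even_mul_succ_self (i - 1)
    rwa [sub_add_cancel, mul_comm] at this
  rw [triangular, Int.toNat_of_nonneg (by positivity), Int.two_mul_ediv_two_of_even h2]

variable {A : Type*} [CommRing A]

theorem pow_mul_prod_range (c : A) (f : ℕ → A) (n : ℕ) :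
    c ^ n * ∏ j ∈ Finset.range n, f j = ∏ j ∈ Finset.range n, c * f j := by
  simp [Finset.prod_mul_distrib]

theorem two_mul_choose_two (k : ℕ) : (2 * k.choose 2 : ℤ) = k * (k - 1) := by
  induction k with
  | zero => simp
  | succ k ih =>
    simp only [Nat.choose_succ_succ' k 1, Nat.choose_one_right]
    push_cast
    linear_combination ih

theorem prod_range_pow_sub_pow (q : A) (n : ℕ) :
    ∏ j ∈ Finset.range n, (q ^ n - q ^ j) = (-1) ^ n * q ^ (n.choose 2) * qPoch q n := by
  induction n with
  | zero => simp [qPoch]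
  | succ n ih =>
    have h : ∏ j ∈ Finset.range n, (q ^ (n + 1) - q ^ (j + 1)) =
        q ^ n * ∏ j ∈ Finset.range n, (q ^ n - q ^ j) := by
      rw [pow_mul_prod_range]
      exact Finset.prod_congr rfl fun j _ => by ring
    rw [Finset.prod_range_succ', h, ih, qPoch_succ, show (n + 1).choose 2 = n + n.choose 2 by
      simp [Nat.choose_succ_succ' n 1]]
    ring

theorem prod_erase_pow_sub_pow (q : A) (n : ℕ) :
    ∏ j ∈ (Finset.range (2 * n + 1)).erase n, (q ^ n - q ^ j) =
      (-1) ^ n * q ^ (n.choose 2 + n * n) * qPoch q n ^ 2 := by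
  have h1 : ∏ j ∈ (Finset.range (2 * n + 1)).erase n, (q ^ n - q ^ j) =
      ∏ j ∈ Finset.range (n + (n + 1)), if j = n then 1 else (q ^ n - q ^ j) := by
    rw [show n + (n + 1) = 2 * n + 1 by ring, 
      ← Finset.prod_erase (a := n) (f := fun j => if j = n then 1 else (q ^ n - q ^ j)) _
        (if_pos rfl)]
    exact Finset.prod_congr rfl fun j hj => (if_neg (Finset.ne_of_mem_erase hj)).symm
  have h2 : ∏ j ∈ Finset.range n, (if j = n then 1 else (q ^ n - q ^ j)) =
      ∏ j ∈ Finset.range n, (q ^ n - q ^ j) :=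
    Finset.prod_congr rfl fun j hj => if_neg (Finset.mem_range.1 hj).ne
  have h3 : ∏ j ∈ Finset.range n, (if n + (j + 1) = n then 1 else (q ^ n - q ^ (n + (j + 1)))) =
      q ^ (n * n) * qPoch q n := by
    rw [pow_mul, qPoch]
    rw [pow_mul_prod_range]
    exact Finset.prod_congr rfl fun j _ => by rw [if_neg (by omega)]; ring
  rw [h1, Finset.prod_range_add, h2, Finset.prod_range_succ', h3, prod_range_pow_sub_pow]
  simp
  ring

theorem prod_range_pow_two_mul_sub (q : A) (n : ℕ) :
    ∏ j ∈ Finset.range (2 * n), (q ^ (2 * n) - q * (q ^ 2) ^ j) =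
      (-1) ^ n * q ^ (3 * n ^ 2) * (∏ j ∈ Finset.range n, (1 - q ^ (2 * j + 1))) ^ 2 := by
  have h1 : ∏ j ∈ Finset.range n, (q ^ (2 * n) - q * (q ^ 2) ^ j) =
      (-1) ^ n * q ^ (n ^ 2) * ∏ j ∈ Finset.range n, (1 - q ^ (2 * j + 1)) := by
    induction n with
    | zero => simp
    | succ n ih =>
      have h : ∏ j ∈ Finset.range n, (q ^ (2 * (n + 1)) - q * (q ^ 2) ^ (j + 1)) =
          (q ^ 2) ^ n * ∏ j ∈ Finset.range n, (q ^ (2 * n) - q * (q ^ 2) ^ j) := by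
        rw [pow_mul_prod_range]
        exact Finset.prod_congr rfl fun j _ => by ring
      rw [Finset.prod_range_succ', h, ih, Finset.prod_range_succ]
      ring
  have h2 : ∏ j ∈ Finset.range n, (q ^ (2 * n) - q * (q ^ 2) ^ (n + j)) =
      q ^ (2 * n ^ 2) * ∏ j ∈ Finset.range n, (1 - q ^ (2 * j + 1)) := by
    rw [show q ^ (2 * n ^ 2) = (q ^ (2 * n)) ^ n by rw [← pow_mul]; ring_nf, pow_mul_prod_range]
    exact Finset.prod_congr rfl fun j _ => by ring
  rw [show Finset.range (2 * n) = Finset.range (n + n) by rw [two_mul],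
    Finset.prod_range_add, h1, h2]
  ring

/-- The sign `(-1) ^ i` for an integer `i`. -/
def intSign (i : ℤ) : ℤ := (i.negOnePow : ℤˣ)

theorem intSign_add (i j : ℤ) : intSign (i + j) = intSign i * intSign j := by
  simp [intSign, Int.negOnePow_add]

theorem intSign_natCast (n : ℕ) : intSign n = (-1) ^ n := by
  simp [intSign, Int.negOnePow_def]

theorem intSign_neg (i : ℤ) : intSign (-i) = intSign i := by
  simp [intSign, Int.negOnePow_neg]

theorem neg_one_pow_mul_intSign_sub (n k : ℕ) :
    (-1) ^ n * intSign ((k : ℤ) - n) = (-1) ^ k := by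
  rw [← intSign_natCast, ← intSign_add, ← intSign_natCast]
  congr 1
  ring

/-- A finite form of Gauss's identity for `∑ (-1) ^ i q ^ (i ^ 2)`. -/
theorem sum_qBinom_sq (n : ℕ) :
    ∑ p ∈ antidiagonal (2 * n),
        monomial (((p.1 : ℤ) - n).natAbs ^ 2) (intSign ((p.1 : ℤ) - n)) *
          qBinom (X ^ 2 : PowerSeries ℤ) p.1 p.2 =
      (∏ j ∈ Finset.range n, (1 - X ^ (2 * j + 1))) ^ 2 := by
  have h := prod_add_mul_pow_eq_sum_qBinom (X ^ 2 : PowerSeries ℤ) (-X) (X ^ (2 * n)) (2 * n)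
  simp only [neg_mul, ← sub_eq_add_neg] at h
  rw [prod_range_pow_two_mul_sub] at h
  have hne : ((-1) ^ n * X ^ (3 * n ^ 2) : PowerSeries ℤ) ≠ 0 :=
    mul_ne_zero (pow_ne_zero _ (by simp)) (pow_ne_zero _ X_ne_zero)
  refine mul_left_cancel₀ hne ?_
  rw [h, Finset.mul_sum]
  refine Finset.sum_congr rfl fun p hp => ?_
  have hp' : p.1 + p.2 = 2 * n := by simpa using hp
  have hsgn := congrArg (C (R := ℤ)) (neg_one_pow_mul_intSign_sub n p.1)
  simp only [map_mul, map_pow, map_neg, map_one] at hsgn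
  have hexp : 3 * n ^ 2 + ((p.1 : ℤ) - n).natAbs ^ 2 =
      2 * p.1.choose 2 + p.1 + 2 * n * p.2 := by
    zify
    rw [sq_abs, two_mul_choose_two]
    have : (p.2 : ℤ) = 2 * n - p.1 := by omega
    rw [this]
    ring
  rw [neg_pow X, ← hsgn, monomial_eq_C_mul_X_pow]
  have hX := congrArg (fun m => (X : PowerSeries ℤ) ^ m) hexp
  simp only [pow_add, pow_mul] at hX ⊢
  linear_combination (-1) ^ n * C (R := ℤ) (intSign (p.1 - n)) *
    qBinom (X ^ 2 : PowerSeries ℤ) p.1 p.2 * hX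

/-- A finite form of Jacobi's identity for `∑ (-1) ^ i (1 - 2 i) q ^ (i (i - 1) / 2)`. -/
theorem sum_qBinom_triangular (n : ℕ) :
    ∑ p ∈ antidiagonal (2 * n + 1),
        monomial (triangular ((p.1 : ℤ) - n))
          (intSign ((p.1 : ℤ) - n) * (1 - 2 * ((p.1 : ℤ) - n))) *
          qBinom (X : PowerSeries ℤ) p.1 p.2 =
      2 * qPoch X n ^ 2 := by
  have h0 := prod_add_mul_pow_eq_sum_qBinom (X : PowerSeries ℤ) (-1) (X ^ n) (2 * n + 1)
  rw [Finset.prod_eq_zero (i := n) (by simp; omega) (by ring)] at h0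
  have h := sum_qBinom_mul_natCast (X : PowerSeries ℤ) (n := n) (N := 2 * n + 1) (by omega)
  rw [prod_erase_pow_sub_pow] at h
  have hne : ((-1) ^ n * X ^ (n.choose 2 + n * n + n) : PowerSeries ℤ) ≠ 0 :=
    mul_ne_zero (pow_ne_zero _ (by simp)) (pow_ne_zero _ X_ne_zero)
  refine mul_left_cancel₀ hne ?_
  -- Here `1 - 2 * (k - n) = 2 * l - (2 * n + 1)` for `k + l = 2 * n + 1`.
  have hcomb := congrArg₂ (fun s t => 2 * s - (2 * (n : PowerSeries ℤ) + 1) * t) h h0.symm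
  refine Eq.trans ?_ (hcomb.trans (by ring))
  rw [Finset.mul_sum, Finset.mul_sum, Finset.mul_sum, ← Finset.sum_sub_distrib]
  refine Finset.sum_congr rfl fun p hp => ?_
  have hp' : p.1 + p.2 = 2 * n + 1 := by simpa using hp
  have hsgn := congrArg (C (R := ℤ)) (neg_one_pow_mul_intSign_sub n p.1)
  simp only [map_mul, map_pow, map_neg, map_one] at hsgn
  have hexp : n.choose 2 + n * n + n + triangular ((p.1 : ℤ) - n) =
      p.1.choose 2 + n * p.2 := by
    have h1 := two_mul_triangular ((p.1 : ℤ) - n)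
    have h2 := two_mul_choose_two n
    have h3 := two_mul_choose_two p.1
    have h4 : (p.2 : ℤ) = 2 * n + 1 - p.1 := by omega
    zify
    rw [h4]
    linarith
  have hcoef : C (R := ℤ) (1 - 2 * ((p.1 : ℤ) - n)) =
      2 * (p.2 : PowerSeries ℤ) - (2 * (n : PowerSeries ℤ) + 1) := by
    have : 1 - 2 * ((p.1 : ℤ) - n) = 2 * p.2 - (2 * n + 1) := by omega
    rw [this]
    simp
  rw [← hsgn, monomial_eq_C_mul_X_pow, map_mul, hcoef]
  have hX := congrArg (fun m => (X : PowerSeries ℤ) ^ m) hexp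
  simp only [pow_add, pow_mul] at hX ⊢
  linear_combination (-1) ^ n * C (R := ℤ) (intSign (p.1 - n)) *
    (2 * (p.2 : PowerSeries ℤ) - (2 * (n : PowerSeries ℤ) + 1)) *
    qBinom (X : PowerSeries ℤ) p.1 p.2 * hX

end FiniteIdentities

/-! ### Passage to the limit -/

section Limits
open Filter Topology

theorem eventually_X_pow_dvd_sub {u : ℕ → PowerSeries ℤ} {a : PowerSeries ℤ}
    (h : Tendsto u atTop (𝓝 a)) (d : ℕ) : ∀ᶠ n in atTop, X ^ d ∣ u n - a := by
  rw [WithPiTopology.tendsto_iff_coeff_tendsto] at h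
  have h1 : ∀ m ∈ Finset.range d, ∀ᶠ n in atTop, coeff m (u n) = coeff m a := fun m _ => by
    have := h m
    rwa [nhds_discrete, tendsto_pure] at this
  filter_upwards [(Filter.eventually_all_finset _).2 h1] with n hn
  refine X_pow_dvd_iff.2 fun m hm => ?_
  rw [map_sub, hn m (Finset.mem_range.2 hm), sub_self]

theorem constantCoeff_qPoch_X_pow {a : ℕ} (ha : a ≠ 0) (n : ℕ) :
    constantCoeff (qPoch (X ^ a : PowerSeries ℤ) n) = 1 := by
  simp [qPoch, map_prod, ← pow_mul, ha]

theorem isUnit_of_tendsto_qPoch {a : ℕ} (ha : a ≠ 0) {f : PowerSeries ℤ}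
    (hf : Tendsto (qPoch (X ^ a)) atTop (𝓝 f)) : IsUnit f := by
  obtain ⟨n, hn⟩ := (eventually_X_pow_dvd_sub hf 1).exists
  rw [pow_one, X_dvd_iff, map_sub, constantCoeff_qPoch_X_pow ha, sub_eq_zero] at hn
  rw [isUnit_iff_constantCoeff, ← hn]
  exact isUnit_one

/-- As `k, l → ∞`, the Gaussian binomial `[k + l choose k]` tends to `1 / (q; q)_∞`. -/
theorem eventually_X_pow_dvd_mul_qBinom_sub_one {a : ℕ} (ha : a ≠ 0) {f : PowerSeries ℤ}
    (hf : Tendsto (qPoch (X ^ a)) atTop (𝓝 f)) (d : ℕ) :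
    ∃ M, ∀ k ≥ M, ∀ l ≥ M, X ^ d ∣ f * qBinom (X ^ a) k l - 1 := by
  have hu := isUnit_of_tendsto_qPoch ha hf
  obtain ⟨M, hM⟩ := eventually_atTop.1 (eventually_X_pow_dvd_sub hf d)
  refine ⟨M, fun k hk l hl => ?_⟩
  rw [← hu.dvd_mul_left]
  have h := qBinom_mul_qPoch (X ^ a : PowerSeries ℤ) k l
  have e : f * (f * qBinom (X ^ a) k l - 1) = (qPoch (X ^ a) (k + l) - f) -
      qBinom (X ^ a) k l * ((qPoch (X ^ a) k - f) * qPoch (X ^ a) l +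
        f * (qPoch (X ^ a) l - f)) := by
    linear_combination h
  rw [e]
  exact dvd_sub (hM _ (by omega)) (Dvd.dvd.mul_left (dvd_add ((hM k hk).mul_right _)
    ((hM l hl).mul_left _)) _)

/-- Letting `n → ∞` in a finite identity whose coefficients are Gaussian binomials of rank
`2 * n + δ` turns it into an identity for a series over all integers. -/
theorem hasSum_of_sum_qBinom {a : ℕ} (ha : a ≠ 0) {f g : PowerSeries ℤ} {G : ℕ → PowerSeries ℤ}
    {δ : ℕ} {e : ℤ → ℕ} {c : ℤ → ℤ} (he : ∀ i, i.natAbs ≤ e i + 1)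
    (hf : Tendsto (qPoch (X ^ a)) atTop (𝓝 f)) (hG : Tendsto G atTop (𝓝 g))
    (h : ∀ n : ℕ, ∑ p ∈ antidiagonal (2 * n + δ),
      monomial (e ((p.1 : ℤ) - n)) (c ((p.1 : ℤ) - n)) * qBinom (X ^ a) p.1 p.2 = G n) :
    HasSum (fun i : ℤ => monomial (e i) (c i)) (f * g) := by
  rw [WithPiTopology.hasSum_iff_hasSum_coeff]
  intro d
  obtain ⟨M, hM⟩ := eventually_X_pow_dvd_mul_qBinom_sub_one ha hf (d + 1)
  obtain ⟨n, hn1, hn⟩ := ((eventually_ge_atTop (M + d + 1)).and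
    (eventually_X_pow_dvd_sub hG (d + 1))).exists
  have hterm : ∀ p ∈ antidiagonal (2 * n + δ),
      X ^ (d + 1) ∣ monomial (e ((p.1 : ℤ) - n)) (c ((p.1 : ℤ) - n)) -
        f * (monomial (e ((p.1 : ℤ) - n)) (c ((p.1 : ℤ) - n)) * qBinom (X ^ a) p.1 p.2) := by
    intro p hp
    have hp' : p.1 + p.2 = 2 * n + δ := by simpa using hp
    have hi := he ((p.1 : ℤ) - n)
    set i := (p.1 : ℤ) - n
    rw [show monomial (e i) (c i) - f * (monomial (e i) (c i) * qBinom (X ^ a) p.1 p.2) =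
      -(monomial (e i) (c i) * (f * qBinom (X ^ a) p.1 p.2 - 1)) by ring, dvd_neg]
    rcases le_or_gt (d + 1) (e i) with hd | hd
    · refine Dvd.dvd.mul_right ?_ _
      rw [monomial_eq_C_mul_X_pow]
      exact (pow_dvd_pow _ hd).mul_left _
    · exact (hM _ (by omega) _ (by omega)).mul_left _
  have hdvd := Finset.dvd_sum hterm
  rw [Finset.sum_sub_distrib, ← Finset.mul_sum, h n] at hdvd
  have hdvd2 : X ^ (d + 1) ∣ f * g - ∑ p ∈ antidiagonal (2 * n + δ),
      monomial (e ((p.1 : ℤ) - n)) (c ((p.1 : ℤ) - n)) := by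
    have := dvd_add hdvd (hn.mul_left f)
    rw [← dvd_neg]
    convert this using 1
    ring
  have hcoeff := X_pow_dvd_iff.1 hdvd2 d (by omega)
  rw [map_sub, sub_eq_zero, map_sum] at hcoeff
  rw [hcoeff, Finset.Nat.sum_antidiagonal_eq_sum_range_succ_mk]
  have hinj : Function.Injective fun k : ℕ => (k : ℤ) - n := fun x y hxy => by
    simpa using hxy
  have hsum := hasSum_sum_of_ne_finset_zero (L := .unconditional ℤ)
    (f := fun i : ℤ => coeff d (monomial (e i) (c i)))
    (s := (Finset.range (2 * n + δ + 1)).map ⟨_, hinj⟩) (fun i hi => by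
      rw [coeff_monomial, if_neg]
      rintro rfl
      have := he i
      refine hi (Finset.mem_map.2 ⟨(i + n).toNat, ?_, ?_⟩)
      · rw [Finset.mem_range]; omega
      · simp; omega)
  rw [Finset.sum_map] at hsum
  exact hsum

end Limits

/-! ### The theta series of Gauss and Jacobi and the pentagonal number theorem -/

section Theta
open Filter Topology

/-- Euler's product `(q; q)_∞ = ∏_{m ≥ 1} (1 - q ^ m)` in `ℤ⟦q⟧`. -/
noncomputable def eulerProd : PowerSeries ℤ := ∏' m : ℕ, (1 - X ^ (m + 1))

theorem hasProd_eulerProd : HasProd (fun m : ℕ => (1 - X ^ (m + 1) : PowerSeries ℤ)) eulerProd :=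
  (WithPiTopology.multipliable_one_sub_X_pow ℤ).hasProd

theorem continuous_expand {p : ℕ} (hp : p ≠ 0) :
    Continuous (expand p hp : PowerSeries ℤ → PowerSeries ℤ) := by
  rw [continuous_iff_continuousAt]
  intro f
  rw [ContinuousAt, WithPiTopology.tendsto_iff_coeff_tendsto]
  intro d
  simp only [coeff_expand]
  split_ifs
  · exact (WithPiTopology.continuous_coeff ℤ _).tendsto f
  · exact tendsto_const_nhds

theorem hasProd_expand_eulerProd {p : ℕ} (hp : p ≠ 0) :
    HasProd (fun m : ℕ => (1 - X ^ (p * (m + 1)) : PowerSeries ℤ)) (expand p hp eulerProd) := by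
  have h := hasProd_eulerProd.map (expand p hp) (continuous_expand hp)
  convert h using 2 with m
  simp [pow_mul]

theorem tendsto_qPoch_X_pow {p : ℕ} (hp : p ≠ 0) :
    Tendsto (qPoch (X ^ p : PowerSeries ℤ)) atTop (𝓝 (expand p hp eulerProd)) := by
  have h := (hasProd_expand_eulerProd hp).tendsto_prod_nat
  simp only [pow_mul] at h
  exact h

theorem isUnit_eulerProd : IsUnit eulerProd := by
  have h := isUnit_of_tendsto_qPoch one_ne_zero (tendsto_qPoch_X_pow one_ne_zero)
  rwa [expand_one_apply] at h

/-- The product `∏_{m ≥ 0} (1 - q ^ (2 m + 1))` in `ℤ⟦q⟧`. -/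
noncomputable def oddProd : PowerSeries ℤ := ∏' m : ℕ, (1 - X ^ (2 * m + 1))

theorem hasProd_oddProd : HasProd (fun m : ℕ => (1 - X ^ (2 * m + 1) : PowerSeries ℤ)) oddProd := by
  refine Multipliable.hasProd ?_
  have key := PowerSeries.WithPiTopology.multipliable_one_add_of_tendsto_order_atTop_nhds_top
    (R := ℤ) (f := fun m : ℕ => -X ^ (2 * m + 1)) (by
      refine ENat.tendsto_nhds_top_iff_natCast_lt.mpr fun n => ?_
      filter_upwards [Filter.eventually_ge_atTop n] with m hm
      rw [order_neg, order_X_pow]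
      exact_mod_cast (by omega))
  simpa [sub_eq_add_neg] using key

theorem oddProd_mul_expand_eulerProd : oddProd * expand 2 two_ne_zero eulerProd = eulerProd := by
  refine HasProd.unique ?_ hasProd_eulerProd
  exact hasProd_oddProd.even_mul_odd (f := fun m => 1 - X ^ (m + 1))
    (hasProd_expand_eulerProd two_ne_zero)

/-- Gauss's theta series `∑ (-1) ^ i q ^ (i ^ 2)`, as a product. -/
noncomputable def gaussTheta : PowerSeries ℤ := expand 2 two_ne_zero eulerProd * oddProd ^ 2

theorem gaussTheta_mul : gaussTheta * expand 2 two_ne_zero eulerProd = eulerProd ^ 2 := by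
  rw [gaussTheta, ← congrArg (· ^ 2) oddProd_mul_expand_eulerProd]
  ring

/-- **Gauss's identity**: `(q; q)_∞ ^ 2 / (q ^ 2; q ^ 2)_∞ = ∑ (-1) ^ i q ^ (i ^ 2)`. -/
theorem hasSum_gaussTheta :
    HasSum (fun i : ℤ => monomial (i.natAbs ^ 2) (intSign i)) gaussTheta := by
  refine hasSum_of_sum_qBinom (e := fun i => i.natAbs ^ 2) (δ := 0) two_ne_zero (fun i => ?_)
    (tendsto_qPoch_X_pow two_ne_zero) (hasProd_oddProd.tendsto_prod_nat.pow 2) sum_qBinom_sq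
  nlinarith

/-- **Jacobi's identity**: `2 (q; q)_∞ ^ 3 = ∑ (-1) ^ i (1 - 2 i) q ^ (i (i - 1) / 2)`, the sum
being over all integers. -/
theorem hasSum_two_mul_eulerProd_pow_three :
    HasSum (fun i : ℤ => monomial (triangular i) (intSign i * (1 - 2 * i)))
      (2 * eulerProd ^ 3) := by
  have h := hasProd_eulerProd.tendsto_prod_nat
  have h1 := tendsto_qPoch_X_pow one_ne_zero
  rw [expand_one_apply] at h1
  have := hasSum_of_sum_qBinom (e := triangular) (c := fun i => intSign i * (1 - 2 * i)) (δ := 1)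
    one_ne_zero (fun i => ?_) h1 ((h.pow 2).const_mul 2) (fun n => by
      simpa only [pow_one, qPoch] using sum_qBinom_triangular n)
  · convert this using 1
    ring
  · have := two_mul_triangular i
    zify
    rcases abs_cases i with ⟨h, _⟩ | ⟨h, _⟩ <;> rw [h] <;> nlinarith

theorem hasSum_expand_eulerProd :
    HasSum (fun i : ℤ => monomial (2 * pentagonal i) (intSign i))
      (expand 2 two_ne_zero eulerProd) := by
  have h := WithPiTopology.hasSum_pentagonalSeries ℤ
  rw [← WithPiTopology.tprod_one_sub_X_pow, ← eulerProd] at h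
  have h2 := h.map (expand 2 two_ne_zero) (continuous_expand two_ne_zero)
  convert h2 using 2 with i
  simp [monomial_eq_C_mul_X_pow, intSign, pow_mul]

theorem finite_fiber_add {ι κ : Type*} {e : ι → ℕ} {e' : κ → ℕ}
    (he : ∀ d, {i | e i = d}.Finite) (he' : ∀ d, {i | e' i = d}.Finite) (d : ℕ) :
    {x : ι × κ | e x.1 + e' x.2 = d}.Finite := by
  have hfin : (⋃ a ∈ Set.Iic d, ⋃ b ∈ Set.Iic d, {i | e i = a} ×ˢ {j | e' j = b}).Finite :=
    (Set.finite_Iic d).biUnion fun a _ => (Set.finite_Iic d).biUnion fun b _ =>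
      (he a).prod (he' b)
  refine hfin.subset fun i hi => ?_
  simp only [Set.mem_ofPred_eq] at hi
  simp
  omega

theorem summable_monomial {ι : Type*} {e : ι → ℕ} {c : ι → ℤ}
    (he : ∀ d, {i | e i = d}.Finite) :
    Summable fun i => (monomial (e i) (c i) : PowerSeries ℤ) := by
  rw [WithPiTopology.summable_iff_summable_coeff]
  intro d
  refine summable_of_hasFiniteSupport ((he d).subset fun i hi => ?_)
  by_contra h
  exact hi ((coeff_monomial _ _ _).trans (if_neg (Ne.symm h)))

theorem t3Space_powerSeries : T3Space (PowerSeries ℤ) :=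
  have : IsTopologicalAddGroup (PowerSeries ℤ) := inferInstance
  have : RegularSpace (PowerSeries ℤ) := IsTopologicalAddGroup.regularSpace _
  {}

theorem HasSum.monomial_mul {ι κ : Type*} {e : ι → ℕ} {c : ι → ℤ} {e' : κ → ℕ} {c' : κ → ℤ}
    {f g : PowerSeries ℤ} (hf : HasSum (fun i => monomial (e i) (c i)) f)
    (hg : HasSum (fun i => monomial (e' i) (c' i)) g)
    (he : ∀ d, {i | e i = d}.Finite) (he' : ∀ d, {i | e' i = d}.Finite) :
    HasSum (fun i : ι × κ => monomial (e i.1 + e' i.2) (c i.1 * c' i.2)) (f * g) := by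
  have hs : Summable fun i : ι × κ =>
      (monomial (e i.1 + e' i.2) (c i.1 * c' i.2) : PowerSeries ℤ) :=
    summable_monomial (finite_fiber_add he he')
  simp only [← monomial_mul_monomial] at hs ⊢
  have h3 := t3Space_powerSeries
  obtain ⟨u, hu⟩ := hs
  have hmul : f * g = u := hf.mul_eq hg hu
  rw [hmul]
  exact hu

end Theta

/-! ### The derivative of the quintuple product identity -/

section Quintuple

theorem finite_fiber_of_natAbs_le {e : ℤ → ℕ} (he : ∀ i, i.natAbs ≤ e i + 1) (d : ℕ) :
    {i | e i = d}.Finite := by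
  refine (Set.finite_Icc (-(d + 1) : ℤ) (d + 1)).subset fun i hi => ?_
  have := he i
  rw [Set.mem_ofPred_eq] at hi
  rw [Set.mem_Icc]
  omega

theorem natAbs_le_triangular (i : ℤ) : i.natAbs ≤ triangular i + 1 := by
  have := two_mul_triangular i
  zify
  rcases abs_cases i with ⟨h, _⟩ | ⟨h, _⟩ <;> rw [h] <;> nlinarith

theorem finite_fiber_sq (d : ℕ) : {i : ℤ | i.natAbs ^ 2 = d}.Finite :=
  finite_fiber_of_natAbs_le (fun i => by nlinarith) d

theorem finite_fiber_pentagonal (d : ℕ) : {i : ℤ | pentagonal i = d}.Finite :=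
  (Set.finite_singleton d).preimage pentagonal_injective.injOn

theorem finite_fiber_two_mul_pentagonal (d : ℕ) : {i : ℤ | 2 * pentagonal i = d}.Finite := by
  refine (finite_fiber_pentagonal (d / 2)).subset fun i hi => ?_
  simp only [Set.mem_ofPred_eq] at hi ⊢
  omega

theorem intSign_congr {i j : ℤ} (h : Even (i - j)) : intSign i = intSign j := by
  rw [intSign, intSign, Int.negOnePow_eq_iff i j |>.2 h]

theorem intSign_add_one (i : ℤ) : intSign (i + 1) = -intSign i := by
  simp [intSign, Int.negOnePow_succ]

/-- A family of monomials that is odd under an involution of the index set sums to zero. -/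
theorem hasSum_zero_of_odd {ι : Type*} {e : ι → ℕ} {c : ι → ℤ} (σ : ι ≃ ι)
    (he : ∀ d, {i | e i = d}.Finite) (heσ : ∀ i, e (σ i) = e i) (hc : ∀ i, c (σ i) = -c i) :
    HasSum (fun i => (monomial (e i) (c i) : PowerSeries ℤ)) 0 := by
  obtain ⟨s, hs⟩ := summable_monomial (c := c) he
  have h2 : HasSum ((fun i => (monomial (e i) (c i) : PowerSeries ℤ)) ∘ σ) s := σ.hasSum_iff.2 hs
  have h3 : ((fun i => (monomial (e i) (c i) : PowerSeries ℤ)) ∘ σ) =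
      fun i => -monomial (e i) (c i) := by
    funext i
    simp [heσ, hc]
  rw [h3] at h2
  have h4 : s = -s := h2.unique hs.neg
  have h5 : s = 0 := by
    ext d
    have := congrArg (coeff d) h4
    rw [map_neg] at this
    rw [map_zero]
    omega
  rwa [h5] at hs

/-- The weight `3/2` theta series `∑ (1 - 6 r) q ^ (r (3 r - 1) / 2)`, summed over all integers. -/
noncomputable def pentagonalTheta : PowerSeries ℤ :=
  ∑' r : ℤ, monomial (pentagonal r) (1 - 6 * r)

theorem hasSum_pentagonalTheta :
    HasSum (fun r : ℤ => monomial (pentagonal r) (1 - 6 * r)) pentagonalTheta :=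
  (summable_monomial finite_fiber_pentagonal).hasSum

/-- The bijection `(s, r, j) ↦ (m, n) = (r + s - 2 j, r + j)`, which sorts the pairs `(m, n)` by
the residue `s` and the quotient `r` of `m + 2 n` modulo `3`. -/
def residueEquiv : Fin 3 × ℤ × ℤ ≃ ℤ × ℤ where
  toFun x := (x.2.1 + (x.1 : ℕ) - 2 * x.2.2, x.2.1 + x.2.2)
  invFun y := (⟨((y.1 + 2 * y.2) % 3).toNat, by omega⟩, (y.1 + 2 * y.2) / 3,
    y.2 - (y.1 + 2 * y.2) / 3)
  left_inv := by
    rintro ⟨⟨s, hs⟩, r, j⟩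
    simp only [Prod.mk.injEq, Fin.mk.injEq]
    omega
  right_inv := by
    rintro ⟨m, n⟩
    simp only [Prod.mk.injEq]
    omega

/-- The double series for `2 (q; q)_∞ ^ 3` times Gauss's theta series. By oddness in `n`, the
weight `1 - 2 m` of Jacobi's identity may be replaced by `1 - 2 (m + 2 n)`. -/
theorem hasSum_eulerProd_pow_three_mul_gaussTheta :
    HasSum (fun x : ℤ × ℤ => monomial (triangular x.1 + x.2.natAbs ^ 2)
      (intSign (x.1 + x.2) * (1 - 2 * (x.1 + 2 * x.2)))) (2 * eulerProd ^ 3 * gaussTheta) := by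
  have hT := finite_fiber_of_natAbs_le natAbs_le_triangular
  have h1 := hasSum_two_mul_eulerProd_pow_three.monomial_mul hasSum_gaussTheta hT finite_fiber_sq
  have hfin : ∀ d, {x : ℤ × ℤ | triangular x.1 + x.2.natAbs ^ 2 = d}.Finite :=
    finite_fiber_add hT finite_fiber_sq
  have h2 := hasSum_zero_of_odd (e := fun x : ℤ × ℤ => triangular x.1 + x.2.natAbs ^ 2)
    (c := fun x => intSign (x.1 + x.2) * (-4 * x.2))
    ((Equiv.refl ℤ).prodCongr (Equiv.neg ℤ)) hfin (fun x => by simp)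
    (fun x => by simp [intSign_add, intSign_neg])
  have h3 := h1.add h2
  rw [add_zero] at h3
  convert h3 using 2 with x
  rw [← map_add]
  congr 1
  rw [intSign_add]
  ring

/-- The derivative at `z = 1` of the quintuple product identity:
`(q; q)_∞ ^ 3 * ∑ (-1) ^ n q ^ (n ^ 2) = (q ^ 2; q ^ 2)_∞ * ∑ (1 - 6 r) q ^ (r (3 r - 1) / 2)`. -/
theorem eulerProd_pow_three_mul_gaussTheta :
    eulerProd ^ 3 * gaussTheta = pentagonalTheta * expand 2 two_ne_zero eulerProd := by
  have hP := hasSum_pentagonalTheta.monomial_mul hasSum_expand_eulerProd finite_fiber_pentagonal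
    finite_fiber_two_mul_pentagonal
  have hJ := residueEquiv.hasSum_iff.2 hasSum_eulerProd_pow_three_mul_gaussTheta
  -- In the class `s = 0` the exponents are `pentagonal r + 2 * pentagonal (-j)`.
  have h0 := ((Equiv.refl ℤ).prodCongr (Equiv.neg ℤ)).hasSum_iff.2 hP
  -- In the class `s = 1` the exponents are `pentagonal (-r) + 2 * pentagonal j`.
  have h1 := ((Equiv.neg ℤ).prodCongr (Equiv.refl ℤ)).hasSum_iff.2 hP
  -- The class `s = 2` is odd under `j ↦ 1 - j`.
  have hfin : ∀ d,
      {x : ℤ × ℤ | triangular (x.1 + 2 - 2 * x.2) + (x.1 + x.2).natAbs ^ 2 = d}.Finite :=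
    fun d => (finite_fiber_add (finite_fiber_of_natAbs_le natAbs_le_triangular)
      finite_fiber_sq d).preimage (f := fun x : ℤ × ℤ => (x.1 + 2 - 2 * x.2, x.1 + x.2))
      (fun x _ y _ h => by
        simp only [Prod.mk.injEq] at h
        exact Prod.ext (by omega) (by omega))
  have h2 := hasSum_zero_of_odd
    (e := fun x : ℤ × ℤ => triangular (x.1 + 2 - 2 * x.2) + (x.1 + x.2).natAbs ^ 2)
    (c := fun x => intSign x.2 * (-3 - 6 * x.1))
    ((Equiv.refl ℤ).prodCongr (Equiv.subLeft 1)) hfin (fun x => by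
      have t1 := two_mul_triangular (x.1 + 2 - 2 * x.2)
      have t2 := two_mul_triangular (x.1 + 2 - 2 * (1 - x.2))
      simp
      zify
      rw [sq_abs, sq_abs]
      linarith) (fun x => by
        have hs : intSign (1 - x.2) = -intSign x.2 := by
          rw [← intSign_add_one]
          exact intSign_congr ⟨-x.2, by ring⟩
        simp [hs])
  have := t3Space_powerSeries
  have hfib := fun hs => hJ.prod_fiberwise (g := ![pentagonalTheta * expand 2 two_ne_zero eulerProd,
    pentagonalTheta * expand 2 two_ne_zero eulerProd, 0]) hs
  have hfib' := hfib (fun s => ?_)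
  · have h := hfib'.unique (hasSum_fintype _)
    rw [Fin.sum_univ_three] at h
    simp only [Matrix.cons_val] at h
    refine mul_left_cancel₀ (fun h2 : (2 : PowerSeries ℤ) = 0 => ?_) ?_
    · have := congrArg constantCoeff h2
      rw [map_ofNat, map_zero] at this
      omega
    linear_combination h
  · match s with
    | 0 =>
      refine (congrArg (fun f => HasSum f (pentagonalTheta * expand 2 two_ne_zero eulerProd))
        (funext fun x => ?_)).mpr h0
      obtain ⟨r, j⟩ := x
      have hs : intSign (r + 0 - 2 * j + (r + j)) = intSign j := intSign_congr ⟨r - j, by ring⟩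
      have he : triangular (r + 0 - 2 * j) + (r + j).natAbs ^ 2 =
          pentagonal r + 2 * pentagonal (-j) := by
        have t1 := two_mul_triangular (r + 0 - 2 * j)
        have t2 := two_mul_natCast_pentagonal r
        have t3 := two_mul_natCast_pentagonal (-j)
        zify
        rw [sq_abs]
        linarith
      simp [residueEquiv, intSign_neg] at hs he ⊢
      rw [hs, he]
      congr 1
      ring
    | 1 =>
      refine (congrArg (fun f => HasSum f (pentagonalTheta * expand 2 two_ne_zero eulerProd))
        (funext fun x => ?_)).mpr h1
      obtain ⟨r, j⟩ := x
      have hs : intSign (r + 1 - 2 * j + (r + j)) = -intSign j := by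
        rw [← intSign_add_one]
        exact intSign_congr ⟨r - j, by ring⟩
      have he : triangular (r + 1 - 2 * j) + (r + j).natAbs ^ 2 =
          pentagonal (-r) + 2 * pentagonal j := by
        have t1 := two_mul_triangular (r + 1 - 2 * j)
        have t2 := two_mul_natCast_pentagonal (-r)
        have t3 := two_mul_natCast_pentagonal j
        zify
        rw [sq_abs]
        linarith
      simp [residueEquiv] at hs he ⊢
      rw [hs, he]
      congr 1
      ring
    | 2 =>
      refine (congrArg (fun f => HasSum f (0 : PowerSeries ℤ)) (funext fun x => ?_)).mpr h2
      obtain ⟨r, j⟩ := x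
      have hs : intSign (r + 2 - 2 * j + (r + j)) = intSign j :=
        intSign_congr ⟨r + 1 - j, by ring⟩
      simp [residueEquiv]
      rw [hs]
      congr 1
      ring

/-- `(q; q)_∞ ^ 5 / (q ^ 2; q ^ 2)_∞ ^ 2 = ∑ (1 - 6 r) q ^ (r (3 r - 1) / 2)`. -/
theorem eulerProd_pow_five :
    eulerProd ^ 5 = pentagonalTheta * expand 2 two_ne_zero eulerProd ^ 2 := by
  linear_combination expand 2 two_ne_zero eulerProd * eulerProd_pow_three_mul_gaussTheta -
    eulerProd ^ 3 * gaussTheta_mul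

end Quintuple

/-! ### Congruences modulo `7` -/

section Congruences

theorem HasSum.dvd_coeff {ι : Type*} {e : ι → ℕ} {c : ι → ℤ} {f : PowerSeries ℤ}
    (h : HasSum (fun i => monomial (e i) (c i)) f) {p : ℤ} {d : ℕ}
    (hp : ∀ i, e i = d → p ∣ c i) : p ∣ coeff d f := by
  have h1 := (WithPiTopology.hasSum_iff_hasSum_coeff ℤ).1 h d
  rw [HasSum, nhds_discrete, Filter.tendsto_pure] at h1
  obtain ⟨s, hs⟩ := h1.exists
  rw [← hs]
  refine Finset.dvd_sum fun i _ => ?_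
  rw [coeff_monomial]
  split_ifs with hi
  · exact hp i hi.symm
  · exact dvd_zero p

theorem diamondSeries_mul_eulerProd_pow (k : ℕ) :
    diamondSeries k * eulerProd ^ (3 * k + 1) = expand 2 two_ne_zero eulerProd ^ k := by
  have h1 := (multipliable_diamondFactor k).hasProd.mul (hasProd_eulerProd.pow (3 * k + 1))
  simp only [diamondFactor_mul k _ (Nat.le_add_left 1 _)] at h1
  exact h1.unique ((hasProd_expand_eulerProd two_ne_zero).pow k)

theorem pow_seven_eq_expand (f : PowerSeries (ZMod 7)) :
    f ^ 7 = expand 7 (by norm_num) f := by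
  have : Fact (Nat.Prime 7) := ⟨by norm_num⟩
  have h := MvPowerSeries.map_frobenius_expand (p := 7) (hp := by norm_num) (f := f)
  rw [ZMod.frobenius_zmod] at h
  exact h.symm

/-- Multiplying or dividing by power series in `q ^ 7` preserves the vanishing of all
coefficients whose index lies in a given residue class modulo `7`. -/
theorem coeff_eq_zero_of_mul_expand {D A U V : PowerSeries (ZMod 7)}
    (hU : IsUnit U) (h : D * expand 7 (by norm_num) U = A * expand 7 (by norm_num) V) {r : ℕ}
    (hr : r < 7) (hA : ∀ n, coeff (7 * n + r) A = 0) (n : ℕ) : coeff (7 * n + r) D = 0 := by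
  obtain ⟨W, hW⟩ := hU.exists_right_inv
  have hD : D = A * expand 7 (by norm_num) (V * W) := by
    rw [map_mul, ← mul_assoc, ← h, mul_assoc, ← map_mul, hW, map_one, mul_one]
  rw [hD, coeff_mul]
  refine Finset.sum_eq_zero fun x hx => ?_
  have hx' : x.1 + x.2 = 7 * n + r := by simpa using hx
  by_cases hd : 7 ∣ x.2
  · obtain ⟨m, hm⟩ := hd
    rw [show x.1 = 7 * (n - m) + r by omega, hA, zero_mul]
  · rw [coeff_expand_of_not_dvd _ _ _ hd, mul_zero]

theorem seven_dvd_coeff_eulerProd_pow_six (n : ℕ) :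
    (7 : ℤ) ∣ coeff (7 * n + 5) (eulerProd ^ 6) := by
  have hT := finite_fiber_of_natAbs_le natAbs_le_triangular
  have h := hasSum_two_mul_eulerProd_pow_three.monomial_mul hasSum_two_mul_eulerProd_pow_three hT hT
  have h4 : (2 * eulerProd ^ 3) * (2 * eulerProd ^ 3) = C 4 * eulerProd ^ 6 := by
    rw [map_ofNat]
    ring
  rw [h4] at h
  have hdvd := h.dvd_coeff (p := 7) (d := 7 * n + 5) ?_
  · rw [coeff_C_mul] at hdvd
    omega
  · rintro ⟨a, b⟩ hab
    have t1 := two_mul_triangular a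
    have t2 := two_mul_triangular b
    -- `-1` is not a square modulo `7`.
    have key : ∀ x y : ZMod 7, x ^ 2 + y ^ 2 = 0 → x = 0 := by decide
    have hz : (1 - 2 * a) ^ 2 + (1 - 2 * b) ^ 2 = 7 * (8 * n + 6) := by
      have : (triangular a : ℤ) + triangular b = 7 * n + 5 := by exact_mod_cast hab
      linear_combination 8 * this - 4 * t1 - 4 * t2
    have ha : (7 : ℤ) ∣ 1 - 2 * a := by
      rw [← Nat.cast_ofNat, ← ZMod.intCast_zmod_eq_zero_iff_dvd]
      refine key _ ((1 - 2 * b : ℤ) : ZMod 7) ?_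
      rw [← Int.cast_pow, ← Int.cast_pow, ← Int.cast_add, hz, ZMod.intCast_zmod_eq_zero_iff_dvd]
      exact dvd_mul_right _ _
    exact (ha.mul_left _).mul_right _

theorem seven_dvd_coeff_pentagonalTheta (n : ℕ) :
    (7 : ℤ) ∣ coeff (7 * n + 2) pentagonalTheta := by
  refine hasSum_pentagonalTheta.dvd_coeff fun r hr => ?_
  have t := two_mul_natCast_pentagonal r
  rw [hr] at t
  push_cast at t
  refine Prime.dvd_of_dvd_pow (n := 2) (by norm_num) ⟨24 * n + 7, ?_⟩
  linear_combination -12 * t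

end Congruences

theorem corollary1p3 (k n : ℕ) :
    diamondCount (7 * k) (7 * n + 5) ≡ 0 [ZMOD 7] ∧
      diamondCount (7 * k + 5) (7 * n + 2) ≡ 0 [ZMOD 7] := by
  let φ := PowerSeries.map (Int.castRingHom (ZMod 7))
  have hφ : ∀ (f : PowerSeries ℤ) (d : ℕ), (7 : ℤ) ∣ coeff d f ↔ coeff d (φ f) = 0 := by
    intro f d
    rw [coeff_map, eq_intCast, ZMod.intCast_zmod_eq_zero_iff_dvd]
    rfl
  have hU : ∀ m, IsUnit (φ eulerProd ^ m) := fun m => (isUnit_eulerProd.map φ).pow m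
  simp only [Int.modEq_zero_iff_dvd, diamondCount]
  constructor
  · rw [hφ]
    refine coeff_eq_zero_of_mul_expand (U := φ eulerProd ^ (3 * k + 1))
      (A := φ (eulerProd ^ 6)) (V := φ (expand 2 two_ne_zero eulerProd) ^ k) (hU _) ?_
      (by norm_num) (fun m => (hφ _ _).1 (seven_dvd_coeff_eulerProd_pow_six m)) n
    have h := diamondSeries_mul_eulerProd_pow (7 * k)
    rw [← pow_seven_eq_expand, ← pow_seven_eq_expand, ← map_pow, ← map_pow, ← map_pow, ← map_pow,
      ← map_mul, ← map_mul]
    refine congrArg φ ?_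
    linear_combination eulerProd ^ 6 * h
  · rw [hφ]
    refine coeff_eq_zero_of_mul_expand (U := φ eulerProd ^ (3 * k + 3))
      (A := φ pentagonalTheta) (V := φ (expand 2 two_ne_zero eulerProd) ^ (k + 1)) (hU _) ?_
      (by norm_num) (fun m => (hφ _ _).1 (seven_dvd_coeff_pentagonalTheta m)) n
    have h := diamondSeries_mul_eulerProd_pow (7 * k + 5)
    rw [← pow_seven_eq_expand, ← pow_seven_eq_expand, ← map_pow, ← map_pow, ← map_pow, ← map_pow,
      ← map_mul, ← map_mul]
    refine congrArg φ ?_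
    linear_combination eulerProd ^ 5 * h +
      expand 2 two_ne_zero eulerProd ^ (7 * k + 5) * eulerProd_pow_five
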